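/- Fix $d\ge 1$. Write $(f*g)(y)=\int_{\mathbb{R}^d} f(x)g(y-x)\,dx$. A module-sequence $\Omega$ on $\mathbb{R}^d$ consists, for every layer $n\ge 1$, of - a countable family of atoms $g_{\lambda}\in L^1(\mathbb{R}^d)\cap L^2(\mathbb{R}^d)$, $\lambda\in\Lambda_n$, forming a semi-discrete frame, i.e. there are $A,B>0$ with $A\|f\|_2^2\le\sum_{\lambda\in\Lambda_n}\|f*g_\lambda\|_2^2\le B\|f\|_2^2$ for all $f\in L^2(\mathbb{R}^d)$ (such a $B$ is called an upper frame bound); - a distinguished index $\lambda_n^\ast\in\Lambda_n$, whose atom $\chi_{n-1}:=g_{\lambda_n^\ast}$ is called output-generating; - Lipschitz-continuous maps $M_n,P_n:L^2(\mathbb{R}^d)\to L^2(\mathbb{R}^d)$ with $M_n0=0$ and $P_n0=0$; - a pooling factor $S_n\ge 1$. It is admissible if for every $n$ there are an upper frame bound $B_n>0$ and Lipschitz constants $L_n>0$ of $M_n$ and $R_n>0$ of $P_n$ with $\max\{B_n,B_nL_n^2R_n^2\}\le 1$. For $\lambda\in\Lambda_n$ put $U_n[\lambda]f:=S_n^{d/2}\,P_n\big(M_n(f*g_\lambda)\big)(S_n\,\cdot)$.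 A path of length $n\ge 0$ is a tuple $q=(\lambda_1,\dots,\lambda_n)$ with $\lambda_k\in\Lambda_k\setminus\{\lambda_k^\ast\}$, and $U[q]f:=U_n[\lambda_n]\cdots U_1[\lambda_1]f$ (with $U[q]f:=f$ for the empty path). The feature extractor is $\Phi_\Omega(f):=\big((U[q]f)*\chi_n\big)_{n\ge 0,\ q\text{ a path of length }n}$, and $|||s|||:=\big(\sum_q\|s_q\|_2^2\big)^{1/2}\in[0,\infty]$ for a family $s=(s_q)$ in $L^2(\mathbb{R}^d)$ indexed by all paths. **Theorem.** For every $d\ge1$ there is a constant $C>0$, depending only on $d$ (in particular not on $\Omega$), such that the following holds for every admissible module-sequence $\Omega$ on $\mathbb{R}^d$, every $R>0$, every $R$-band-limited $f\in L^2(\mathbb{R}^d)$ (i.e. $\hat f$ vanishes a.e. outside the ball $B_R(0)$, where $\hat f(\xi)=\int f(x)e^{-2\pi i\langle x,\xi\rangle}dx$, extended to $L^2$), every continuous $\omega:\mathbb{R}^d\to\mathbb{R}$, and every $C^1$ map $\tau:\mathbb{R}^d\to\mathbb{R}^d$ with $\|D\tau\|_\infty:=\sup_x\max_{i,j}|\partial_j\tau_i(x)|\le\frac1{2d}$: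 the function $(F_{\tau,\omega}f)(x):=e^{2\pi i\omega(x)}f(x-\tau(x))$ is in $L^2(\mathbb{R}^d)$, and $$|||\Phi_\Omega(F_{\tau,\omega}f)-\Phi_\Omega(f)|||\le C\big(R\|\tau\|_\infty+\|\omega\|_\infty\big)\|f\|_2,$$ where $\|\tau\|_\infty=\sup_x|\tau(x)|$ with the Euclidean norm and $\|\omega\|_\infty=\sup_x|\omega(x)|$, both in $[0,\infty]$, with the convention $\infty\cdot 0=0$. -/

import Mathlib

open MeasureTheory FourierTransform
open scoped ENNReal NNReal Convolution

universe u

noncomputable section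

namespace DeepFeature

/-- The signal domain `ℝᵈ` with its Euclidean norm and Lebesgue measure. -/
abbrev Dom (d : ℕ) : Type := EuclideanSpace ℝ (Fin d)

/-- The signal space `L²(ℝᵈ)` of complex-valued functions modulo a.e. equality. -/
abbrev L2 (d : ℕ) : Type := Lp (α := Dom d) ℂ 2 volume

/-- The convolution `(f ∗ g)(y) = ∫ f(x) g(y - x) dx` as a function on `ℝᵈ`. -/
def convFun {d : ℕ} (f g : Dom d → ℂ) : Dom d → ℂ :=
  f ⋆[ContinuousLinearMap.mul ℂ ℂ, volume] g

theorem convFun_apply {d : ℕ} (f g : Dom d → ℂ) (y : Dom d) :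
    convFun f g y = ∫ x, f x * g (y - x) := rfl

theorem enorm_convFun_sq_le {d : ℕ} {f g : Dom d → ℂ} (hf : AEStronglyMeasurable f volume)
    (hg : AEStronglyMeasurable g volume) (y : Dom d) :
    ‖convFun f g y‖ₑ ^ (2 : ℝ) ≤
      (∫⁻ x, ‖f x‖ₑ ^ (2 : ℝ) * ‖g (y - x)‖ₑ) * ∫⁻ x, ‖g x‖ₑ := by
  have hgy : AEMeasurable (fun x => ‖g (y - x)‖ₑ) volume :=
    (hg.comp_quasiMeasurePreserving
      (Measure.measurePreserving_sub_left volume y).quasiMeasurePreserving).enorm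
  have h1 : ‖convFun f g y‖ₑ ≤ ∫⁻ x, ‖f x‖ₑ * ‖g (y - x)‖ₑ := by
    rw [convFun_apply]
    refine (enorm_integral_le_lintegral_enorm _).trans (le_of_eq ?_)
    simp only [enorm_mul]
  have h2 := ENNReal.lintegral_mul_norm_pow_le (μ := (volume : Measure (Dom d)))
    (f := fun x => ‖f x‖ₑ ^ (2 : ℝ) * ‖g (y - x)‖ₑ) (g := fun x => ‖g (y - x)‖ₑ)
    ((hf.enorm.pow_const 2).mul hgy) hgy (p := 1 / 2) (q := 1 / 2)
    (by norm_num) (by norm_num) (by norm_num)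
  have h3 : ∀ x, (‖f x‖ₑ ^ (2 : ℝ) * ‖g (y - x)‖ₑ) ^ (1 / 2 : ℝ) * ‖g (y - x)‖ₑ ^ (1 / 2 : ℝ)
      = ‖f x‖ₑ * ‖g (y - x)‖ₑ := by
    intro x
    rw [ENNReal.mul_rpow_of_nonneg _ _ (by norm_num), ← ENNReal.rpow_mul, mul_assoc,
      ← ENNReal.rpow_add_of_nonneg _ _ (by norm_num) (by norm_num)]
    norm_num
  simp only [h3] at h2
  have h4 : ∫⁻ x, ‖g (y - x)‖ₑ = ∫⁻ x, ‖g x‖ₑ :=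
    lintegral_sub_left_eq_self (fun x => ‖g x‖ₑ) y
  rw [h4, ← ENNReal.mul_rpow_of_nonneg _ _ (by norm_num)] at h2
  calc ‖convFun f g y‖ₑ ^ (2 : ℝ)
      ≤ (((∫⁻ x, ‖f x‖ₑ ^ (2 : ℝ) * ‖g (y - x)‖ₑ) * ∫⁻ x, ‖g x‖ₑ) ^ (1 / 2 : ℝ)) ^ (2 : ℝ) :=
        ENNReal.rpow_le_rpow (h1.trans h2) (by norm_num)
    _ = _ := by rw [← ENNReal.rpow_mul]; norm_num

/-- The convolution of an `L²` function with an `L¹` function is in `L²`. -/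
theorem memLp_convFun {d : ℕ} {f g : Dom d → ℂ} (hf : MemLp f 2 volume) (hg : MemLp g 1 volume) :
    MemLp (convFun f g) 2 volume := by
  have hprod := hf.1.convolution_integrand (μ := (volume : Measure (Dom d)))
    (ContinuousLinearMap.mul ℂ ℂ) hg.1
  refine ⟨hprod.integral_prod_right', ?_⟩
  have hg1 : ∫⁻ x, ‖g x‖ₑ < ∞ := by
    have := hg.2
    rwa [eLpNorm_one_eq_lintegral_enorm] at this
  have hf2 : ∫⁻ x, ‖f x‖ₑ ^ (2 : ℝ) < ∞ := by
    have := lintegral_rpow_enorm_lt_top_of_eLpNorm_lt_top (by norm_num) (by norm_num) hf.2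
    simpa using this
  rw [eLpNorm_lt_top_iff_lintegral_rpow_enorm_lt_top (by norm_num) (by norm_num)]
  simp only [ENNReal.toReal_ofNat]
  refine lt_of_le_of_lt (lintegral_mono fun y => enorm_convFun_sq_le hf.1 hg.1 y) ?_
  rw [lintegral_mul_const' _ _ hg1.ne]
  refine ENNReal.mul_lt_top ?_ hg1
  have hm : AEMeasurable (fun p : Dom d × Dom d => ‖f p.2‖ₑ ^ (2 : ℝ) * ‖g (p.1 - p.2)‖ₑ)
      ((volume : Measure (Dom d)).prod volume) :=
    ((hf.1.comp_quasiMeasurePreserving Measure.quasiMeasurePreserving_snd).enorm.pow_const 2).mul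
      (hg.1.comp_quasiMeasurePreserving
        (quasiMeasurePreserving_sub_of_right_invariant volume volume)).enorm
  rw [lintegral_lintegral_swap hm]
  have h5 : ∀ x : Dom d, ∫⁻ y, ‖f x‖ₑ ^ (2 : ℝ) * ‖g (y - x)‖ₑ
      = ‖f x‖ₑ ^ (2 : ℝ) * ∫⁻ y, ‖g y‖ₑ := by
    intro x
    rw [lintegral_const_mul' _ _ (by simp),
      lintegral_sub_right_eq_self (fun y => ‖g y‖ₑ) x]
  simp only [h5]
  rw [lintegral_mul_const' _ _ hg1.ne]
  exact ENNReal.mul_lt_top hf2 hg1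

/-- The convolution operator `f ↦ f ∗ g` on `L²(ℝᵈ)`, for `g ∈ L¹(ℝᵈ)`. -/
def conv {d : ℕ} (g : Dom d → ℂ) (hg : MemLp g 1 volume) (f : L2 d) : L2 d :=
  (memLp_convFun (Lp.memLp f) hg).toLp (convFun f g)

theorem memLp_comp_smul {d : ℕ} {h : Dom d → ℂ} (hh : MemLp h 2 volume) {S : ℝ} (hS : 1 ≤ S) :
    MemLp (fun x => ((S ^ ((d : ℝ) / 2) : ℝ) : ℂ) * h (S • x)) 2 volume := by
  have hS0 : S ≠ 0 := by positivity
  refine MemLp.const_mul (f := fun x => h (S • x)) ?_ _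
  refine MemLp.comp_of_map (f := fun x : Dom d => S • x) ?_
    (measurable_const_smul S).aemeasurable
  rw [Measure.map_addHaar_smul volume hS0]
  exact hh.smul_measure ENNReal.ofReal_ne_top

/-- The continuous-time sub-sampling `h ↦ S^{d/2} h(S ·)` on `L²(ℝᵈ)`, for `S ≥ 1`. -/
def dilate {d : ℕ} (S : ℝ) (hS : 1 ≤ S) (h : L2 d) : L2 d :=
  (memLp_comp_smul (Lp.memLp h) hS).toLp
    (fun x => ((S ^ ((d : ℝ) / 2) : ℝ) : ℂ) * h (S • x))

/-- `A` is a lower frame bound of `{T_b I g_λ}`: `A ‖f‖² ≤ ∑_λ ‖f ∗ g_λ‖²` for all `f ∈ L²`.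
Here `(f ∗ g_λ)(b) = ⟨f, T_b I g_λ⟩`, where `(I g)(x) = conj (g (-x))`, so the sum equals
`∑_λ ∫ |⟨f, T_b I g_λ⟩|² db`. -/
def IsLowerFrameBound {d : ℕ} {Λ : Type*} (g : Λ → Dom d → ℂ) (hg : ∀ l, MemLp (g l) 1 volume)
    (A : ℝ) : Prop :=
  ∀ f : L2 d, ENNReal.ofReal A * ‖f‖ₑ ^ 2 ≤ ∑' l, ‖conv (g l) (hg l) f‖ₑ ^ 2

/-- `B` is an upper frame bound of `{T_b I g_λ}`: `∑_λ ‖f ∗ g_λ‖² ≤ B ‖f‖²` for all `f ∈ L²`. -/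
def IsUpperFrameBound {d : ℕ} {Λ : Type*} (g : Λ → Dom d → ℂ) (hg : ∀ l, MemLp (g l) 1 volume)
    (B : ℝ) : Prop :=
  ∀ f : L2 d, ∑' l, ‖conv (g l) (hg l) f‖ₑ ^ 2 ≤ ENNReal.ofReal B * ‖f‖ₑ ^ 2

/-- The atoms `g_λ` generate a semi-discrete frame `{T_b I g_λ}` for `L²(ℝᵈ)`. -/
def IsSemiDiscreteFrame {d : ℕ} {Λ : Type*} (g : Λ → Dom d → ℂ)
    (hg : ∀ l, MemLp (g l) 1 volume) : Prop :=
  ∃ A B : ℝ, 0 < A ∧ 0 < B ∧ IsLowerFrameBound g hg A ∧ IsUpperFrameBound g hg B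

/-- A module-sequence on `ℝᵈ`, together with the pooling factor and the output-generating atom of
each layer. Layers are numbered from `0`: index `n` here is the `(n + 1)`-st network layer, so
`atom n (out n)` is the output-generating atom `χ_n` (used on paths of length `n`). -/
structure ModuleSequence (d : ℕ) where
  /-- The index set `Λ_{n+1}` of the atoms. -/
  Idx : ℕ → Type u
  /-- The index sets are countable. -/
  countable_idx : ∀ n, Countable (Idx n)
  /-- The atoms `g_λ`. -/
  atom : ∀ n, Idx n → Dom d → ℂ
  /-- The atoms are in `L¹(ℝᵈ)`. -/
  atom_memLp_one : ∀ n l, MemLp (atom n l) 1 volume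
  /-- The atoms are in `L²(ℝᵈ)`. -/
  atom_memLp_two : ∀ n l, MemLp (atom n l) 2 volume
  /-- The atoms generate a semi-discrete frame. -/
  frame : ∀ n, IsSemiDiscreteFrame (atom n) (atom_memLp_one n)
  /-- The index of the output-generating atom. -/
  out : ∀ n, Idx n
  /-- The non-linearity. -/
  M : ℕ → L2 d → L2 d
  /-- The non-linearity is Lipschitz-continuous. -/
  M_lipschitz : ∀ n, ∃ L : ℝ≥0, LipschitzWith L (M n)
  /-- The non-linearity maps `0` to `0`. -/
  M_zero : ∀ n, M n 0 = 0
  /-- The pooling operator. -/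
  P : ℕ → L2 d → L2 d
  /-- The pooling operator is Lipschitz-continuous. -/
  P_lipschitz : ∀ n, ∃ L : ℝ≥0, LipschitzWith L (P n)
  /-- The pooling operator maps `0` to `0`. -/
  P_zero : ∀ n, P n 0 = 0
  /-- The pooling factor. -/
  S : ℕ → ℝ
  /-- The pooling factor is at least `1`. -/
  one_le_S : ∀ n, 1 ≤ S n

namespace ModuleSequence

variable {d : ℕ} (Ω : ModuleSequence.{u} d)

/-- Admissibility: in every layer there are an upper frame bound `B` and Lipschitz constants
`L` of `M` and `R` of `P`, all positive, with `max {B, B L² R²} ≤ 1`. -/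
def Admissible : Prop :=
  ∀ n, ∃ (B : ℝ) (L R : ℝ≥0), 0 < B ∧ 0 < L ∧ 0 < R ∧
    IsUpperFrameBound (Ω.atom n) (Ω.atom_memLp_one n) B ∧
    LipschitzWith L (Ω.M n) ∧ LipschitzWith R (Ω.P n) ∧
    max B (B * (L : ℝ) ^ 2 * (R : ℝ) ^ 2) ≤ 1

/-- The operator `f ↦ S^{d/2} P(M(f ∗ g_λ))(S ·)` of a layer. -/
def layer (n : ℕ) (l : Ω.Idx n) (f : L2 d) : L2 d :=
  dilate (Ω.S n) (Ω.one_le_S n) (Ω.P n (Ω.M n (conv (Ω.atom n l) (Ω.atom_memLp_one n l) f)))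

/-- Paths of length `n`; the indices of the output-generating atoms are left out. -/
def Path (n : ℕ) : Type u := (k : Fin n) → {l : Ω.Idx k // l ≠ Ω.out k}

/-- The propagated signal `U[q] f` along the path `q = (λ_1, …, λ_n)`. -/
def propagate : (n : ℕ) → Ω.Path n → L2 d → L2 d
  | 0, _, f => f
  | n + 1, q, f =>
      Ω.layer n (q (Fin.last n)).1 (propagate n (fun k => q k.castSucc) f)

/-- The feature extractor: its component at a path `q` of length `n` is `(U[q] f) ∗ χ_n`. -/
def feature (f : L2 d) : (Σ n, Ω.Path n) → L2 d := fun q =>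
  conv (Ω.atom q.1 (Ω.out q.1)) (Ω.atom_memLp_one q.1 (Ω.out q.1)) (Ω.propagate q.1 q.2 f)

end ModuleSequence

/-- The norm `|||s||| = (∑_q ‖s_q‖₂²)^{1/2}`, with values in `[0, ∞]`. -/
def tripleNorm {d : ℕ} {Q : Type*} (s : Q → L2 d) : ℝ≥0∞ :=
  (∑' q, ‖s q‖ₑ ^ 2) ^ (1 / 2 : ℝ)

/-- `f ∈ L²(ℝᵈ)` is `R`-band-limited: its Fourier transform (the extension to `L²` of
`∫ f(x) e^{-2πi⟨x,ξ⟩} dx`) is supported in the ball of radius `R` about the origin. -/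
def BandLimited {d : ℕ} (R : ℝ) (f : L2 d) : Prop :=
  ∀ᵐ ξ : Dom d, ξ ∉ Metric.ball (0 : Dom d) R → (𝓕 f : L2 d) ξ = 0

/-- The deformation `(F_{τ,ω} f)(x) = e^{2πi ω(x)} f(x - τ(x))`. -/
def deform {d : ℕ} (τ : Dom d → Dom d) (ω : Dom d → ℝ) (f : Dom d → ℂ) : Dom d → ℂ :=
  fun x => Complex.exp (2 * Real.pi * Complex.I * ω x) * f (x - τ x)

/-- The supremum norm `‖v‖_∞ = sup_x |v(x)|`, with values in `[0, ∞]`. -/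
def supNorm {d : ℕ} {F : Type*} [NormedAddCommGroup F] (v : Dom d → F) : ℝ≥0∞ :=
  ⨆ x, ‖v x‖ₑ

/-- The norm `‖Dτ‖_∞ = sup_x max_{i,j} |∂_j τ_i(x)|` of the Jacobian matrix,
with values in `[0, ∞]`. -/
def jacobianSupNorm {d : ℕ} (τ : Dom d → Dom d) : ℝ≥0∞ :=
  ⨆ (x : Dom d) (i : Fin d) (j : Fin d), ‖(fderiv ℝ τ x (EuclideanSpace.single j 1)) i‖ₑ

end DeepFeature

end

noncomputable section

namespace DeepFeature

/-! The estimate decouples the network from the signal. On the network side, convolution is linear,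
sub-sampling is a linear isometry, and admissibility balances frame bound against Lipschitz
constants. Hence for two inputs the squared distance emitted by a layer plus the squared distance
passed on is at most the squared distance received. Telescoping over depth makes the feature
extractor non-expansive (`tripleNorm_feature_sub_le`), so only `F_{τ,ω} f - f` in `L²` remains, and
no constant depends on `Ω`.

On the signal side, the Jacobian bound makes `τ` a `1/2`-Lipschitz map, so every `x ↦ x - tτ(x)`
with `|t| ≤ 1` contracts distances by at most the factor `2` and composition with it is bounded on
`L²`. Integrating the gradient along the segment from `x` to `x - τ(x)` bounds the displacement
error by `‖τ‖_∞ ‖∇h‖₂`, and Bernstein's inequality turns the gradient into a multiple of `R`. This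
is done for band-limited Schwartz functions and carried to `f` by density. The modulation costs
`|e^{2πiω} - 1| ≤ 2π|ω|`. -/

/-! ### Linearity of convolution and sub-sampling -/

theorem tsum_eq_add_tsum_ne {ι : Type*} (F : ι → ℝ≥0∞) (a : ι) :
    ∑' l, F l = F a + ∑' l : {l // l ≠ a}, F l.1 := by
  rw [← ENNReal.summable.tsum_add_tsum_compl (f := F) (s := {a}) ENNReal.summable,
    tsum_singleton a F]
  rfl

theorem conv_sub {d : ℕ} (g : Dom d → ℂ) (hg : MemLp g 1 volume) (hg2 : MemLp g 2 volume)
    (a b : L2 d) : conv g hg (a - b) = conv g hg a - conv g hg b := by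
  -- Since the atom is also in `L²`, the integrand is integrable at every `y`, not merely almost
  -- every one.
  have hint : ∀ (h : L2 d) (y : Dom d), Integrable (fun x => h x * g (y - x)) volume := by
    intro h y
    have h2 : MemLp (fun x => g (y - x)) 2 volume :=
      hg2.comp_measurePreserving (Measure.measurePreserving_sub_left volume y)
    exact (Lp.memLp h).integrable_mul h2
  refine Lp.ext ?_
  refine (MemLp.coeFn_toLp _).trans ?_
  refine Filter.EventuallyEq.trans ?_ (Lp.coeFn_sub _ _).symm
  filter_upwards [MemLp.coeFn_toLp (memLp_convFun (Lp.memLp a) hg),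
    MemLp.coeFn_toLp (memLp_convFun (Lp.memLp b) hg)] with y hya hyb
  rw [Pi.sub_apply, conv, conv, hya, hyb, convFun_apply, convFun_apply, convFun_apply,
    ← integral_sub (hint a y) (hint b y)]
  refine integral_congr_ae ?_
  filter_upwards [Lp.coeFn_sub a b] with x hx
  rw [hx, Pi.sub_apply, sub_mul]

theorem quasiMeasurePreserving_smul {d : ℕ} {S : ℝ} (hS : S ≠ 0) :
    Measure.QuasiMeasurePreserving (fun x : Dom d => S • x) volume volume :=
  ⟨measurable_const_smul S, by
    rw [Measure.map_addHaar_smul volume hS]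
    exact Measure.smul_absolutelyContinuous⟩

theorem dilate_sub {d : ℕ} {S : ℝ} (hS : 1 ≤ S) (a b : L2 d) :
    dilate S hS (a - b) = dilate S hS a - dilate S hS b := by
  refine Lp.ext ?_
  refine (MemLp.coeFn_toLp _).trans ?_
  refine Filter.EventuallyEq.trans ?_ (Lp.coeFn_sub _ _).symm
  have hS0 : S ≠ 0 := by positivity
  filter_upwards [MemLp.coeFn_toLp (memLp_comp_smul (Lp.memLp a) hS),
    MemLp.coeFn_toLp (memLp_comp_smul (Lp.memLp b) hS),
    (quasiMeasurePreserving_smul hS0).ae (Lp.coeFn_sub a b)] with y hya hyb hy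
  rw [Pi.sub_apply, dilate, dilate, hya, hyb, hy, Pi.sub_apply, mul_sub]

theorem enorm_dilate {d : ℕ} {S : ℝ} (hS : 1 ≤ S) (h : L2 d) : ‖dilate S hS h‖ₑ = ‖h‖ₑ := by
  have hS0 : 0 < S := by positivity
  have hmeas : AEStronglyMeasurable h (volume.map (fun x : Dom d => S • x)) :=
    (Lp.aestronglyMeasurable h).mono_ac (quasiMeasurePreserving_smul hS0.ne').absolutelyContinuous
  have h1 : eLpNorm (fun x : Dom d => h (S • x)) 2 volume
      = ENNReal.ofReal ((S ^ d)⁻¹) ^ (1 / 2 : ℝ) * eLpNorm h 2 volume := by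
    have := eLpNorm_map_measure (p := 2) hmeas (measurable_const_smul S).aemeasurable
    rw [Function.comp_def] at this
    rw [← this, Measure.map_addHaar_smul volume hS0.ne',
      eLpNorm_smul_measure_of_ne_top (by norm_num), finrank_euclideanSpace_fin,
      abs_of_nonneg (by positivity), smul_eq_mul]
    norm_num
  rw [dilate, Lp.enorm_toLp, Lp.enorm_def]
  have h2 := eLpNorm_const_smul (((S ^ ((d : ℝ) / 2) : ℝ) : ℂ)) (fun x : Dom d => h (S • x)) 2 volume
  have h3 : (((S ^ ((d : ℝ) / 2) : ℝ) : ℂ)) • (fun x : Dom d => h (S • x))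
      = fun x => ((S ^ ((d : ℝ) / 2) : ℝ) : ℂ) * h (S • x) := rfl
  rw [h3] at h2
  rw [h2, h1, ← mul_assoc]
  have h4 : ‖((S ^ ((d : ℝ) / 2) : ℝ) : ℂ)‖ₑ = ENNReal.ofReal (S ^ ((d : ℝ) / 2)) := by
    rw [← ofReal_norm, Complex.norm_real, Real.norm_of_nonneg (by positivity)]
  -- The normalisation `S^{d/2}` cancels the square root of the Jacobian factor `S^{-d}`.
  have h5 : S ^ ((d : ℝ) / 2) * ((S ^ d)⁻¹) ^ (1 / 2 : ℝ) = 1 := by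
    rw [Real.inv_rpow (by positivity), ← Real.rpow_natCast, ← Real.rpow_mul hS0.le,
      mul_one_div]
    exact mul_inv_cancel₀ (by positivity)
  rw [h4, ENNReal.ofReal_rpow_of_nonneg (by positivity) (by norm_num),
    ← ENNReal.ofReal_mul (by positivity), h5, ENNReal.ofReal_one, one_mul]

/-! ### Non-expansiveness of the feature extractor -/

namespace ModuleSequence

variable {d : ℕ} (Ω : ModuleSequence.{u} d)

theorem enorm_layer_sub_le {n : ℕ} {L R : ℝ≥0} (hL : LipschitzWith L (Ω.M n))
    (hR : LipschitzWith R (Ω.P n)) (l : Ω.Idx n) (a b : L2 d) :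
    ‖Ω.layer n l a - Ω.layer n l b‖ₑ ≤
      R * L * ‖conv (Ω.atom n l) (Ω.atom_memLp_one n l) (a - b)‖ₑ := by
  rw [layer, layer, ← dilate_sub, enorm_dilate, conv_sub _ _ (Ω.atom_memLp_two n l),
    ← edist_eq_enorm_sub, ← edist_eq_enorm_sub]
  exact_mod_cast (hR.comp hL) _ _

/-- An admissible layer does not increase the distance of two signals. -/
theorem tsum_layer_sub_add_le (hΩ : Ω.Admissible) (n : ℕ) (a b : L2 d) :
    ‖conv (Ω.atom n (Ω.out n)) (Ω.atom_memLp_one n (Ω.out n)) a -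
        conv (Ω.atom n (Ω.out n)) (Ω.atom_memLp_one n (Ω.out n)) b‖ₑ ^ 2 +
      ∑' l : {l : Ω.Idx n // l ≠ Ω.out n}, ‖Ω.layer n l.1 a - Ω.layer n l.1 b‖ₑ ^ 2
      ≤ ‖a - b‖ₑ ^ 2 := by
  obtain ⟨B, L, R, hB, -, -, hfr, hL, hR, hmax⟩ := hΩ n
  -- One weight for both kinds of atoms: `1` suffices for the output atom, `(RL)²` for the
  -- propagated ones. Admissibility says exactly `K B ≤ 1`.
  set K : ℝ≥0 := max 1 ((R * L) ^ 2) with hK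
  set F : Ω.Idx n → ℝ≥0∞ := fun l => ‖conv (Ω.atom n l) (Ω.atom_memLp_one n l) (a - b)‖ₑ ^ 2
    with hF
  have hKB : (K : ℝ≥0∞) * ENNReal.ofReal B ≤ 1 := by
    rw [← ENNReal.ofReal_coe_nnreal, ← ENNReal.ofReal_mul (by positivity),
      ← ENNReal.ofReal_one]
    refine ENNReal.ofReal_le_ofReal ?_
    rw [hK, NNReal.coe_max, max_mul_of_nonneg _ _ hB.le]
    refine le_trans (le_of_eq ?_) hmax
    push_cast
    congr 1
    · ring
    · ring
  have hsplit := tsum_eq_add_tsum_ne F (Ω.out n)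
  calc _ ≤ (K : ℝ≥0∞) * F (Ω.out n) +
        ∑' l : {l : Ω.Idx n // l ≠ Ω.out n}, (K : ℝ≥0∞) * F l.1 := by
        refine add_le_add ?_ (ENNReal.tsum_le_tsum fun l => ?_)
        · rw [← conv_sub _ _ (Ω.atom_memLp_two n _)]
          refine le_mul_of_one_le_left zero_le ?_
          exact_mod_cast le_max_left _ _
        · refine (pow_le_pow_left' (Ω.enorm_layer_sub_le hL hR l.1 a b) 2).trans ?_
          rw [mul_pow]
          refine mul_le_mul_left ?_ _
          exact_mod_cast le_max_right _ _
    _ = K * ∑' l, F l := by rw [ENNReal.tsum_mul_left, ← mul_add, ← hsplit]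
    _ ≤ K * (ENNReal.ofReal B * ‖a - b‖ₑ ^ 2) := mul_le_mul_right (hfr _) _
    _ ≤ ‖a - b‖ₑ ^ 2 := by
        rw [← mul_assoc]
        exact mul_le_of_le_one_left zero_le hKB

/-- A path of length `n + 1` is a path of length `n` together with a last index. -/
def pathSnoc (n : ℕ) : {l : Ω.Idx n // l ≠ Ω.out n} × Ω.Path n ≃ Ω.Path (n + 1) :=
  Fin.snocEquiv (fun k : Fin (n + 1) => {l : Ω.Idx k // l ≠ Ω.out k})

theorem tsum_path_succ (n : ℕ) (F : Ω.Path (n + 1) → ℝ≥0∞) :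
    ∑' q, F q = ∑' p : Ω.Path n, ∑' l : {l : Ω.Idx n // l ≠ Ω.out n},
      F (Ω.pathSnoc n (l, p)) := by
  rw [← (Ω.pathSnoc n).tsum_eq F, ENNReal.tsum_prod', ENNReal.tsum_comm]

theorem pathSnoc_last (n : ℕ) (p : Ω.Path n) (l : {l : Ω.Idx n // l ≠ Ω.out n}) :
    Ω.pathSnoc n (l, p) (Fin.last n) = l :=
  Fin.snoc_last (α := fun k : Fin (n + 1) => {l : Ω.Idx k // l ≠ Ω.out k}) l p

theorem pathSnoc_castSucc (n : ℕ) (p : Ω.Path n) (l : {l : Ω.Idx n // l ≠ Ω.out n})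
    (k : Fin n) : Ω.pathSnoc n (l, p) k.castSucc = p k :=
  Fin.snoc_castSucc (α := fun k : Fin (n + 1) => {l : Ω.Idx k // l ≠ Ω.out k}) l p k

theorem propagate_pathSnoc (n : ℕ) (p : Ω.Path n) (l : {l : Ω.Idx n // l ≠ Ω.out n})
    (f : L2 d) :
    Ω.propagate (n + 1) (Ω.pathSnoc n (l, p)) f = Ω.layer n l.1 (Ω.propagate n p f) := by
  have h1 : (fun k : Fin n => Ω.pathSnoc n (l, p) k.castSucc) = p :=
    funext (Ω.pathSnoc_castSucc n p l)
  have h2 := Ω.pathSnoc_last n p l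
  change Ω.layer n (Ω.pathSnoc n (l, p) (Fin.last n)).1
    (Ω.propagate n (fun k => Ω.pathSnoc n (l, p) k.castSucc) f) = _
  rw [h1]
  exact congrArg (fun z : {l : Ω.Idx n // l ≠ Ω.out n} => Ω.layer n z.1 (Ω.propagate n p f)) h2

/-- The one-layer energy balance, summed over all nodes of depth `n`; this is the telescoping step.
-/
theorem tsum_feature_sub_add_le (hΩ : Ω.Admissible) (a b : L2 d) (n : ℕ) :
    ∑' q : Ω.Path n, ‖Ω.feature a ⟨n, q⟩ - Ω.feature b ⟨n, q⟩‖ₑ ^ 2 +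
        ∑' q : Ω.Path (n + 1), ‖Ω.propagate (n + 1) q a - Ω.propagate (n + 1) q b‖ₑ ^ 2 ≤
      ∑' q : Ω.Path n, ‖Ω.propagate n q a - Ω.propagate n q b‖ₑ ^ 2 := by
  rw [tsum_path_succ, ← ENNReal.tsum_add]
  refine ENNReal.tsum_le_tsum fun p => ?_
  simp only [propagate_pathSnoc]
  exact Ω.tsum_layer_sub_add_le hΩ n _ _

/-- The feature extractor of an admissible module-sequence is non-expansive. -/
theorem tripleNorm_feature_sub_le (hΩ : Ω.Admissible) (a b : L2 d) :
    tripleNorm (Ω.feature a - Ω.feature b) ≤ ‖a - b‖ₑ := by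
  -- The distance still travelling at depth `N` is kept for the induction and discarded only in the
  -- limit.
  have key : ∀ N : ℕ, ∑ n ∈ Finset.range N,
        ∑' q : Ω.Path n, ‖Ω.feature a ⟨n, q⟩ - Ω.feature b ⟨n, q⟩‖ₑ ^ 2 +
      ∑' q : Ω.Path N, ‖Ω.propagate N q a - Ω.propagate N q b‖ₑ ^ 2 ≤ ‖a - b‖ₑ ^ 2 := by
    intro N
    induction N with
    | zero =>
      have : Unique (Ω.Path 0) := inferInstanceAs (Unique ((k : Fin 0) → _))
      rw [Finset.sum_range_zero, zero_add, tsum_eq_single default]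
      · rfl
      · exact fun q hq => (hq (Subsingleton.elim _ _)).elim
    | succ N ih =>
      rw [Finset.sum_range_succ, add_assoc]
      exact (add_le_add_right (Ω.tsum_feature_sub_add_le hΩ a b N) _).trans ih
  have h2 : ∑' q, ‖(Ω.feature a - Ω.feature b) q‖ₑ ^ 2 ≤ ‖a - b‖ₑ ^ 2 := by
    rw [ENNReal.tsum_sigma', ENNReal.tsum_eq_iSup_nat]
    exact iSup_le fun N => le_self_add.trans (key N)
  calc _ ≤ (‖a - b‖ₑ ^ 2) ^ (1 / 2 : ℝ) := ENNReal.rpow_le_rpow h2 (by norm_num)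
    _ = ‖a - b‖ₑ := by
      rw [← ENNReal.rpow_natCast, ← ENNReal.rpow_mul]
      norm_num

end ModuleSequence

/-! ### Changes of variables by `id - tτ` -/

/-- Passing from `ℓ²` to `ℓ¹` on the input and from coordinates to `ℓ²` on the output costs `√d`
each, so entries of size `1/(2d)` give operator norm `1/2`. -/
theorem norm_fderiv_le_half {d : ℕ} (hd : 0 < d) {τ : Dom d → Dom d}
    (hJ : jacobianSupNorm τ ≤ ENNReal.ofReal (1 / (2 * (d : ℝ)))) (x : Dom d) :
    ‖fderiv ℝ τ x‖ ≤ 1 / 2 := by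
  have hd' : (0 : ℝ) < d := by exact_mod_cast hd
  have hent : ∀ i j : Fin d, ‖(fderiv ℝ τ x (EuclideanSpace.single j 1)) i‖ ≤ 1 / (2 * (d : ℝ)) := by
    intro i j
    have h1 : ‖(fderiv ℝ τ x (EuclideanSpace.single j 1)) i‖ₑ ≤
        ENNReal.ofReal (1 / (2 * (d : ℝ))) :=
      (le_iSup (fun j => ‖(fderiv ℝ τ x (EuclideanSpace.single j 1)) i‖ₑ) j).trans
        ((le_iSup (fun i => ⨆ j, ‖(fderiv ℝ τ x (EuclideanSpace.single j 1)) i‖ₑ) i).trans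
          ((le_iSup (fun x => ⨆ (i) (j), ‖(fderiv ℝ τ x (EuclideanSpace.single j 1)) i‖ₑ) x).trans
            hJ))
    rw [← ofReal_norm] at h1
    exact (ENNReal.ofReal_le_ofReal_iff (by positivity)).1 h1
  refine ContinuousLinearMap.opNorm_le_bound _ (by norm_num) fun v => ?_
  have hv : ∑ j, ‖v j‖ ≤ Real.sqrt d * ‖v‖ := by
    refine Real.le_sqrt_of_sq_le (x := ∑ j, ‖v j‖) (y := d * ‖v‖ ^ 2) ?_ |>.trans ?_
    · rw [EuclideanSpace.norm_sq_eq]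
      simpa using sq_sum_le_card_mul_sum_sq (s := (Finset.univ : Finset (Fin d)))
        (f := fun j => ‖v j‖)
    · rw [Real.sqrt_mul hd'.le, Real.sqrt_sq (norm_nonneg _)]
  have hcoord : ∀ i, ‖(fderiv ℝ τ x v) i‖ ≤ 1 / (2 * (d : ℝ)) * (Real.sqrt d * ‖v‖) := by
    intro i
    have hexp : v = ∑ j, v j • EuclideanSpace.single j (1 : ℝ) := by
      conv_lhs => rw [← (EuclideanSpace.basisFun (Fin d) ℝ).sum_repr v]
      simp
    have h2 : (fderiv ℝ τ x v) i = ∑ j, v j * (fderiv ℝ τ x (EuclideanSpace.single j 1)) i := by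
      conv_lhs => rw [hexp]
      simp
    rw [h2]
    calc _ ≤ ∑ j, ‖v j‖ * (1 / (2 * (d : ℝ))) := by
          refine (norm_sum_le _ _).trans (Finset.sum_le_sum fun j _ => ?_)
          rw [norm_mul]
          exact mul_le_mul_of_nonneg_left (hent i j) (norm_nonneg _)
      _ = 1 / (2 * (d : ℝ)) * ∑ j, ‖v j‖ := by rw [← Finset.sum_mul, mul_comm]
      _ ≤ _ := mul_le_mul_of_nonneg_left hv (by positivity)
  rw [EuclideanSpace.norm_eq]
  refine Real.sqrt_le_iff.2 ⟨by positivity, ?_⟩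
  calc ∑ i, ‖(fderiv ℝ τ x v) i‖ ^ 2
      ≤ ∑ _i : Fin d, (1 / (2 * (d : ℝ)) * (Real.sqrt d * ‖v‖)) ^ 2 :=
        Finset.sum_le_sum fun i _ => pow_le_pow_left₀ (norm_nonneg _) (hcoord i) 2
    _ = (1 / 2 * ‖v‖) ^ 2 := by
        rw [Finset.sum_const, Finset.card_univ, Fintype.card_fin, nsmul_eq_mul, mul_pow, mul_pow,
          Real.sq_sqrt hd'.le]
        field_simp

theorem lipschitzWith_half {d : ℕ} (hd : 0 < d) {τ : Dom d → Dom d} (hτ : ContDiff ℝ 1 τ)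
    (hJ : jacobianSupNorm τ ≤ ENNReal.ofReal (1 / (2 * (d : ℝ)))) : LipschitzWith (1 / 2) τ :=
  lipschitzWith_of_nnnorm_fderiv_le (hτ.differentiable one_ne_zero) fun x => by
    exact_mod_cast norm_fderiv_le_half hd hJ x

theorem antilipschitzWith_sub_smul {E : Type*} [NormedAddCommGroup E] [NormedSpace ℝ E]
    {τ : E → E} (hτ : LipschitzWith (1 / 2) τ) {t : ℝ} (ht : |t| ≤ 1) :
    AntilipschitzWith 2 fun x => x - t • τ x := by
  refine AntilipschitzWith.of_le_mul_dist fun x y => ?_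
  have h1 := hτ.dist_le_mul x y
  rw [dist_eq_norm, dist_eq_norm] at h1
  rw [dist_eq_norm, dist_eq_norm]
  have h2 : ‖x - y‖ ≤ ‖x - t • τ x - (y - t • τ y)‖ + ‖t • (τ x - τ y)‖ := by
    refine le_trans (le_of_eq ?_) (norm_add_le _ _)
    congr 1
    rw [smul_sub]
    abel
  rw [norm_smul, Real.norm_eq_abs] at h2
  have h3 : |t| * ‖τ x - τ y‖ ≤ ‖τ x - τ y‖ := mul_le_of_le_one_left (norm_nonneg _) ht
  push_cast at h1 ⊢
  linarith

/-- A continuous map that contracts distances at most by the factor `K` pushes Lebesgue measure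
forward to at most `K ^ d` times itself. -/
theorem map_le_of_antilipschitzWith {d : ℕ} {K : ℝ≥0} {φ : Dom d → Dom d} (hφ : Continuous φ)
    (hK : AntilipschitzWith K φ) :
    (volume : Measure (Dom d)).map φ ≤ ((K : ℝ≥0∞) ^ d) • volume := by
  have hfin : Module.finrank ℝ (Dom d) = d := finrank_euclideanSpace_fin
  -- Lebesgue measure is a multiple of Hausdorff measure, whose behaviour under antilipschitz
  -- preimages needs no Jacobian determinant or surjectivity.
  have hvol := Measure.isAddLeftInvariant_eq_smul (volume : Measure (Dom d))
    (Measure.hausdorffMeasure (Module.finrank ℝ (Dom d)))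
  generalize Measure.addHaarScalarFactor (volume : Measure (Dom d))
    (Measure.hausdorffMeasure (Module.finrank ℝ (Dom d))) = c at hvol
  refine Measure.le_iff.2 fun s hs => ?_
  rw [Measure.map_apply hφ.measurable hs, hvol]
  have h := hK.hausdorffMeasure_preimage_le (d := (Module.finrank ℝ (Dom d) : ℝ))
    (Nat.cast_nonneg _) s
  rw [hfin, ENNReal.rpow_natCast] at h
  simp only [Measure.smul_apply, smul_eq_mul, hfin, ENNReal.smul_def]
  calc _ ≤ (c : ℝ≥0∞) * ((K : ℝ≥0∞) ^ d * Measure.hausdorffMeasure (d : ℝ) s) :=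
        mul_le_mul_right h _
    _ = _ := by ring

theorem quasiMeasurePreserving_of_antilipschitzWith {d : ℕ} {φ : Dom d → Dom d}
    (hφ : Continuous φ) (hK : AntilipschitzWith 2 φ) :
    Measure.QuasiMeasurePreserving φ volume volume :=
  ⟨hφ.measurable, (map_le_of_antilipschitzWith hφ hK).absolutelyContinuous.trans
    Measure.smul_absolutelyContinuous⟩

theorem lintegral_comp_le_of_antilipschitzWith {d : ℕ} {φ : Dom d → Dom d}
    (hφ : Continuous φ) (hK : AntilipschitzWith 2 φ) {G : Dom d → ℝ≥0∞} (hG : Measurable G) :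
    ∫⁻ x, G (φ x) ≤ 2 ^ d * ∫⁻ x, G x := by
  rw [← lintegral_map hG hφ.measurable]
  refine (lintegral_mono' (map_le_of_antilipschitzWith hφ hK) le_rfl).trans (le_of_eq ?_)
  rw [lintegral_smul_measure]
  norm_num

theorem eLpNorm_comp_le_of_antilipschitzWith {d : ℕ} {φ : Dom d → Dom d}
    (hφ : Continuous φ) (hK : AntilipschitzWith 2 φ) {F : Type*} [NormedAddCommGroup F] {f : Dom d → F}
    (hf : AEStronglyMeasurable f volume) :
    eLpNorm (fun x => f (φ x)) 2 volume ≤ 2 ^ d * eLpNorm f 2 volume := by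
  have h1 := eLpNorm_map_measure (p := 2) (hf.mono_ac
    (quasiMeasurePreserving_of_antilipschitzWith hφ hK).absolutelyContinuous)
    hφ.measurable.aemeasurable
  rw [Function.comp_def] at h1
  rw [← h1]
  refine (eLpNorm_mono_measure _ (map_le_of_antilipschitzWith hφ hK)).trans ?_
  rw [eLpNorm_smul_measure_of_ne_top (by norm_num), smul_eq_mul]
  refine mul_le_mul_left ?_ _
  -- The factor obtained is `(2^d)^{1/2}`, rounded up to `2^d`.
  refine (ENNReal.rpow_le_rpow_of_exponent_le ?_ (?_ : _ ≤ (1 : ℝ))).trans ?_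
  · exact one_le_pow₀ (by norm_num)
  · norm_num
  · norm_num

theorem memLp_comp_of_antilipschitzWith {d : ℕ} {φ : Dom d → Dom d}
    (hφ : Continuous φ) (hK : AntilipschitzWith 2 φ) {F : Type*} [NormedAddCommGroup F] {f : Dom d → F}
    (hf : MemLp f 2 volume) : MemLp (fun x => f (φ x)) 2 volume :=
  ⟨hf.1.comp_quasiMeasurePreserving (quasiMeasurePreserving_of_antilipschitzWith hφ hK),
    (eLpNorm_comp_le_of_antilipschitzWith hφ hK hf.1).trans_lt
      (ENNReal.mul_lt_top (by finiteness) hf.2)⟩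

/-! ### Displacement controlled by the gradient -/

theorem eLpNorm_two_sq {α F : Type*} [MeasurableSpace α] {μ : Measure α} [NormedAddCommGroup F]
    (f : α → F) : eLpNorm f 2 μ ^ 2 = ∫⁻ x, ‖f x‖ₑ ^ 2 ∂μ := by
  have := eLpNorm_nnreal_pow_eq_lintegral (f := f) (μ := μ) (p := 2) two_ne_zero
  simp only [NNReal.coe_ofNat, ENNReal.rpow_ofNat, ENNReal.coe_ofNat] at this
  exact this

theorem enorm_le_supNorm {d : ℕ} {F : Type*} [NormedAddCommGroup F] (v : Dom d → F) (x : Dom d) :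
    ‖v x‖ₑ ≤ supNorm v :=
  le_iSup (fun x => ‖v x‖ₑ) x

/-- Fundamental theorem of calculus along the segment, then `L¹ ≤ L²` on the probability space `(0,
1]`. -/
theorem enorm_sub_sub_sq_le {E : Type*} [NormedAddCommGroup E] [NormedSpace ℝ E]
    {h : E → ℂ} (hh : ContDiff ℝ 1 h) (x v : E) :
    ‖h (x - v) - h x‖ₑ ^ 2 ≤
      ‖v‖ₑ ^ 2 * ∫⁻ t in Set.Ioc (0 : ℝ) 1, ‖fderiv ℝ h (x - t • v)‖ₑ ^ 2 := by
  have hcont : Continuous fun t : ℝ => fderiv ℝ h (x - t • v) :=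
    (hh.continuous_fderiv one_ne_zero).comp (by fun_prop)
  have hderiv : ∀ t : ℝ, HasDerivAt (fun t : ℝ => h (x - t • v))
      (fderiv ℝ h (x - t • v) (-v)) t := by
    intro t
    have h1 : HasDerivAt (fun t : ℝ => x - t • v) (-v) t := by
      simpa using ((hasDerivAt_id t).smul_const v).const_sub x
    exact (hh.differentiable one_ne_zero _).hasFDerivAt.comp_hasDerivAt t h1
  have hftc := intervalIntegral.integral_eq_sub_of_hasDerivAt (a := 0) (b := 1)
    (fun t _ => hderiv t) ((hcont.clm_apply continuous_const).intervalIntegrable _ _)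
  rw [intervalIntegral.integral_of_le zero_le_one] at hftc
  simp only [one_smul, zero_smul, sub_zero] at hftc
  have : IsProbabilityMeasure ((volume : Measure ℝ).restrict (Set.Ioc 0 1)) := ⟨by simp⟩
  have hjensen := eLpNorm_le_eLpNorm_of_exponent_le (p := 1) (q := 2)
    (μ := (volume : Measure ℝ).restrict (Set.Ioc 0 1)) (by norm_num) hcont.aestronglyMeasurable
  rw [← eLpNorm_two_sq, ← mul_pow, ← hftc]
  refine pow_le_pow_left' ?_ 2
  calc _ ≤ ∫⁻ t in Set.Ioc (0 : ℝ) 1, ‖fderiv ℝ h (x - t • v) (-v)‖ₑ :=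
        enorm_integral_le_lintegral_enorm _
    _ ≤ ∫⁻ t in Set.Ioc (0 : ℝ) 1, ‖v‖ₑ * ‖fderiv ℝ h (x - t • v)‖ₑ := by
        refine lintegral_mono fun t => ?_
        rw [mul_comm, ← enorm_neg v]
        exact ContinuousLinearMap.le_opENorm _ _
    _ = ‖v‖ₑ * eLpNorm (fun t : ℝ => fderiv ℝ h (x - t • v)) 1
          ((volume : Measure ℝ).restrict (Set.Ioc 0 1)) := by
        rw [eLpNorm_one_eq_lintegral_enorm, lintegral_const_mul' _ _ enorm_ne_top]
    _ ≤ _ := mul_le_mul_right hjensen _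

/-- The distance of a `C¹` function to its composition with `id - τ` is controlled by the
gradient. -/
theorem eLpNorm_comp_sub_sub_le {d : ℕ} {τ : Dom d → Dom d} (hτ : LipschitzWith (1 / 2) τ)
    {h : Dom d → ℂ} (hh : ContDiff ℝ 1 h) :
    eLpNorm (fun x => h (x - τ x) - h x) 2 volume ≤
      supNorm τ * (2 ^ d * eLpNorm (fderiv ℝ h) 2 volume) := by
  have hGc : Continuous (fderiv ℝ h) := hh.continuous_fderiv one_ne_zero
  have hG : Measurable fun y => ‖fderiv ℝ h y‖ₑ ^ 2 := hGc.enorm.measurable.pow_const 2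
  have hm : Measurable fun p : Dom d × ℝ => ‖fderiv ℝ h (p.1 - p.2 • τ p.1)‖ₑ ^ 2 :=
    hG.comp (Continuous.measurable (by have := hτ.continuous; fun_prop))
  have hsq : eLpNorm (fun x => h (x - τ x) - h x) 2 volume ^ 2 ≤
      (supNorm τ * (2 ^ d * eLpNorm (fderiv ℝ h) 2 volume)) ^ 2 := by
    rw [eLpNorm_two_sq, mul_pow, mul_pow, eLpNorm_two_sq]
    calc _ ≤ ∫⁻ x, supNorm τ ^ 2 *
          ∫⁻ t in Set.Ioc (0 : ℝ) 1, ‖fderiv ℝ h (x - t • τ x)‖ₑ ^ 2 := by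
          refine lintegral_mono fun x => (enorm_sub_sub_sq_le hh x (τ x)).trans ?_
          exact mul_le_mul_left (pow_le_pow_left' (enorm_le_supNorm τ x) 2) _
      _ = supNorm τ ^ 2 * ∫⁻ t in Set.Ioc (0 : ℝ) 1, ∫⁻ x,
            ‖fderiv ℝ h (x - t • τ x)‖ₑ ^ 2 := by
          -- Tonelli: for fixed `t` the inner integral is now a change of variables by `id - tτ`.
          rw [lintegral_const_mul _ hm.lintegral_prod_right', lintegral_lintegral_swap]
          exact hm.aemeasurable
      _ ≤ supNorm τ ^ 2 * ∫⁻ _t in Set.Ioc (0 : ℝ) 1, 2 ^ d * ∫⁻ y, ‖fderiv ℝ h y‖ₑ ^ 2 := by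
          refine mul_le_mul_right (setLIntegral_mono' measurableSet_Ioc fun t ht => ?_) _
          have ht1 : |t| ≤ 1 := by rw [abs_of_pos ht.1]; exact ht.2
          exact lintegral_comp_le_of_antilipschitzWith
            (by have := hτ.continuous; fun_prop) (antilipschitzWith_sub_smul hτ ht1) hG
      _ ≤ _ := by
          refine mul_le_mul_right ?_ _
          rw [lintegral_const]
          simp only [MeasurableSet.univ, Measure.restrict_apply, Set.univ_inter, Real.volume_Ioc,
            sub_zero, ENNReal.ofReal_one, mul_one]
          refine mul_le_mul_left (le_self_pow₀ (one_le_pow₀ (by norm_num)) two_ne_zero) _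
  exact (ENNReal.pow_le_pow_left_iff two_ne_zero).1 hsq

/-! ### Bernstein's inequality and approximation of band-limited functions -/

open SchwartzMap in
theorem eLpNorm_fourier_schwartz {d : ℕ} (h : 𝓢(Dom d, ℂ)) :
    eLpNorm (𝓕 h : 𝓢(Dom d, ℂ)) 2 volume = eLpNorm h 2 volume := by
  have := SchwartzMap.norm_fourier_toL2_eq h
  rw [SchwartzMap.norm_toLp, SchwartzMap.norm_toLp] at this
  exact (ENNReal.toReal_eq_toReal_iff' ((𝓕 h).memLp 2 volume).2.ne (h.memLp 2 volume).2.ne).1 this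

theorem norm_clm_le_sum {d : ℕ} (A : Dom d →L[ℝ] ℂ) :
    ‖A‖ ≤ ∑ j, ‖A (EuclideanSpace.single j 1)‖ := by
  refine ContinuousLinearMap.opNorm_le_bound _ (by positivity) fun v => ?_
  have hexp : v = ∑ j, v j • EuclideanSpace.single j (1 : ℝ) := by
    conv_lhs => rw [← (EuclideanSpace.basisFun (Fin d) ℝ).sum_repr v]
    simp
  conv_lhs => rw [hexp]
  rw [map_sum, Finset.sum_mul]
  refine (norm_sum_le _ _).trans (Finset.sum_le_sum fun j _ => ?_)
  rw [map_smul, norm_smul, mul_comm]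
  exact mul_le_mul_of_nonneg_left (PiLp.norm_apply_le v j) (norm_nonneg _)

open SchwartzMap in
open scoped LineDeriv in
/-- Bernstein's inequality for the gradient of a Schwartz function. -/
theorem eLpNorm_fderiv_le {d : ℕ} {r : ℝ} (h : 𝓢(Dom d, ℂ))
    (hsupp : ∀ ξ, r ≤ ‖ξ‖ → (𝓕 h : 𝓢(Dom d, ℂ)) ξ = 0) :
    eLpNorm (fderiv ℝ h) 2 volume ≤
      d * (ENNReal.ofReal (2 * Real.pi * r) * eLpNorm h 2 volume) := by
  have hj : ∀ j : Fin d, eLpNorm (∂_{EuclideanSpace.single j (1 : ℝ)} h : 𝓢(Dom d, ℂ)) 2 volume ≤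
      ENNReal.ofReal (2 * Real.pi * r) * eLpNorm h 2 volume := by
    intro j
    rw [← eLpNorm_fourier_schwartz, ← eLpNorm_fourier_schwartz h]
    refine eLpNorm_le_mul_eLpNorm_of_ae_le_mul (Filter.Eventually.of_forall fun ξ => ?_) 2
    have htg : (fun x : Dom d => inner ℝ x (EuclideanSpace.single j (1 : ℝ))).HasTemperateGrowth :=
      ((innerSL ℝ).flip (EuclideanSpace.single j (1 : ℝ))).hasTemperateGrowth
    -- On the Fourier side the derivative is multiplication by `2πi ξ_j`, and `|ξ_j| ≤ r` wherever
    -- the transform can be nonzero.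
    rw [SchwartzMap.fourier_lineDerivOp_eq, smul_apply,
      SchwartzMap.smulLeftCLM_apply_apply htg, norm_smul, norm_smul, ← mul_assoc]
    rcases le_or_gt r ‖ξ‖ with hξ | hξ
    · rw [hsupp ξ hξ]
      simp
    · refine mul_le_mul_of_nonneg_right ?_ (norm_nonneg _)
      have h1 : ‖(inner ℝ ξ (EuclideanSpace.single j (1 : ℝ)) : ℝ)‖ ≤ r := by
        refine (norm_inner_le_norm _ _).trans ?_
        simpa using hξ.le
      have h2 : ‖(2 * Real.pi * Complex.I : ℂ)‖ = 2 * Real.pi := by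
        simp [abs_of_pos Real.pi_pos]
      rw [h2]
      exact mul_le_mul_of_nonneg_left h1 (by positivity)
  calc eLpNorm (fderiv ℝ h) 2 volume
      ≤ eLpNorm (∑ j : Fin d, fun x =>
          ‖(∂_{EuclideanSpace.single j (1 : ℝ)} h : 𝓢(Dom d, ℂ)) x‖) 2 volume := by
        refine eLpNorm_mono_real fun x => (norm_clm_le_sum _).trans (le_of_eq ?_)
        rw [Finset.sum_apply]
        rfl
    _ ≤ ∑ j : Fin d, eLpNorm (fun x =>
          ‖(∂_{EuclideanSpace.single j (1 : ℝ)} h : 𝓢(Dom d, ℂ)) x‖) 2 volume :=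
        eLpNorm_sum_le (fun j _ => (SchwartzMap.continuous _).norm.aestronglyMeasurable)
          (by norm_num)
    _ ≤ ∑ _j : Fin d, ENNReal.ofReal (2 * Real.pi * r) * eLpNorm h 2 volume :=
        Finset.sum_le_sum fun j _ => by rw [eLpNorm_norm]; exact hj j
    _ = _ := by simp

theorem fourier_sub_Lp {d : ℕ} (u v : L2 d) : 𝓕 (u - v) = 𝓕 u - 𝓕 v :=
  (Lp.fourierTransformₗᵢ (Dom d) ℂ).map_sub u v

open SchwartzMap in
/-- A band-limited `L²` function is approximated by band-limited Schwartz functions. -/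
theorem exists_schwartz_bandLimited {d : ℕ} {R : ℝ} (hR : 0 < R) {u : L2 d}
    (hu : BandLimited R u) {ε : ℝ} (hε : 0 < ε) :
    ∃ h : 𝓢(Dom d, ℂ), (∀ ξ, 2 * R ≤ ‖ξ‖ → (𝓕 h : 𝓢(Dom d, ℂ)) ξ = 0) ∧
      ‖u - h.toLp 2 volume‖ ≤ ε := by
  obtain ⟨ψ, hψ⟩ := (SchwartzMap.denseRange_toLpCLM (E := Dom d) (F := ℂ) (p := 2)
    (μ := volume) ENNReal.ofNat_ne_top).exists_dist_lt (𝓕 u) hε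
  rw [SchwartzMap.toLpCLM_apply, dist_eq_norm] at hψ
  -- The cutoff is `1` on the band, so it fixes `𝓕 u` and cannot increase the distance to it.
  -- Smoothness forces a larger support, whence `2 * R`.
  let χ : ContDiffBump (0 : Dom d) := ⟨R, 2 * R, hR, by linarith⟩
  have hχ : (χ : Dom d → ℝ).HasTemperateGrowth :=
    χ.hasCompactSupport.hasTemperateGrowth χ.contDiff
  refine ⟨𝓕⁻ (SchwartzMap.smulLeftCLM ℂ χ ψ), fun ξ hξ => ?_, ?_⟩
  · rw [FourierTransform.fourier_fourierInv_eq, SchwartzMap.smulLeftCLM_apply_apply hχ,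
      χ.zero_of_le_dist (by simpa using hξ), zero_smul]
  · rw [← SchwartzMap.toLp_fourierInv_eq, ← Lp.norm_fourier_eq, fourier_sub_Lp,
      FourierTransform.fourier_fourierInv_eq]
    refine le_trans (Lp.norm_le_norm_of_ae_le ?_) hψ.le
    filter_upwards [hu, Lp.coeFn_sub (𝓕 u) (ψ.toLp 2 volume), ψ.coeFn_toLp 2 volume,
      Lp.coeFn_sub (𝓕 u) ((SchwartzMap.smulLeftCLM ℂ χ ψ).toLp 2 volume),
      (SchwartzMap.smulLeftCLM ℂ χ ψ).coeFn_toLp 2 volume] with ξ h1 h2 h3 h4 h5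
    rw [h2, h4, Pi.sub_apply, Pi.sub_apply, h3, h5, SchwartzMap.smulLeftCLM_apply_apply hχ]
    by_cases hξ : ξ ∈ Metric.ball (0 : Dom d) R
    · rw [χ.one_of_mem_closedBall (Metric.ball_subset_closedBall hξ), one_smul]
    · rw [h1 hξ, zero_sub, zero_sub, norm_neg, norm_neg, norm_smul,
        Real.norm_of_nonneg χ.nonneg]
      exact mul_le_of_le_one_left (norm_nonneg _) χ.le_one

open SchwartzMap in
-- Density argument: `f` is replaced by a Schwartz `h` with band `2R`, at errors `f - h` and `(f -
-- h) ∘ (id - τ)` of order `ε`. Finiteness of `‖τ‖_∞` makes the remaining error `c ε` vanish as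
-- well.
theorem eLpNorm_comp_sub_sub_le_of_bandLimited {d : ℕ} {R : ℝ} (hR : 0 < R) {f : Dom d → ℂ}
    (hf : MemLp f 2 volume) (hb : BandLimited R (hf.toLp f)) {τ : Dom d → Dom d}
    (hτ : LipschitzWith (1 / 2) τ) (hT : supNorm τ ≠ ∞) :
    eLpNorm (fun x => f (x - τ x) - f x) 2 volume ≤
      supNorm τ * (2 ^ d * (d * (ENNReal.ofReal (2 * Real.pi * (2 * R)) *
        eLpNorm f 2 volume))) := by
  have hφ : Continuous fun x => x - τ x := continuous_id.sub hτ.continuous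
  have hK : AntilipschitzWith 2 fun x => x - τ x := by
    simpa using antilipschitzWith_sub_smul hτ (t := 1) (by simp)
  set c : ℝ≥0∞ := supNorm τ * (2 ^ d * (d * ENNReal.ofReal (2 * Real.pi * (2 * R)))) with hc
  have hctop : c ≠ ∞ := by rw [hc]; finiteness
  have key : ∀ ε : ℝ, 0 < ε → eLpNorm (fun x => f (x - τ x) - f x) 2 volume ≤
      ENNReal.ofReal ε * (2 ^ d + c + 1) + c * eLpNorm f 2 volume := by
    intro ε hε
    obtain ⟨h, hsupp, hdist⟩ := exists_schwartz_bandLimited hR hb hε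
    have hh := h.memLp 2 volume
    have hfh : eLpNorm (f - ⇑h) 2 volume ≤ ENNReal.ofReal ε := by
      have h1 : ‖hf.toLp f - hh.toLp h‖ ≤ ε := hdist
      rw [← MemLp.toLp_sub, Lp.norm_toLp] at h1
      exact (ENNReal.le_ofReal_iff_toReal_le (hf.sub hh).2.ne hε.le).2 h1
    have hhf : eLpNorm h 2 volume ≤ ENNReal.ofReal ε + eLpNorm f 2 volume := by
      calc eLpNorm h 2 volume = eLpNorm ((⇑h - f) + f) 2 volume := by rw [sub_add_cancel]
        _ ≤ eLpNorm (⇑h - f) 2 volume + eLpNorm f 2 volume :=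
          eLpNorm_add_le (hh.sub hf).1 hf.1 (by norm_num)
        _ ≤ _ := by
          rw [eLpNorm_sub_comm]
          exact add_le_add_left hfh _
    have hgrad := eLpNorm_comp_sub_sub_le hτ (h.smooth 1)
    have hsplit : (fun x => f (x - τ x) - f x) =
        ((fun x => (f - ⇑h) (x - τ x)) + fun x => h (x - τ x) - h x) + (⇑h - f) := by
      funext x
      simp only [Pi.add_apply, Pi.sub_apply]
      ring
    have hm1 : AEStronglyMeasurable (fun x => (f - ⇑h) (x - τ x)) volume :=
      (memLp_comp_of_antilipschitzWith hφ hK (hf.sub hh)).1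
    have hm2 : AEStronglyMeasurable (fun x => h (x - τ x) - h x) volume :=
      ((h.continuous.comp hφ).sub h.continuous).aestronglyMeasurable
    rw [hsplit]
    calc _ ≤ eLpNorm (fun x => (f - ⇑h) (x - τ x)) 2 volume +
          eLpNorm (fun x => h (x - τ x) - h x) 2 volume + eLpNorm (⇑h - f) 2 volume :=
          (eLpNorm_add_le (hm1.add hm2) (hh.sub hf).1 (by norm_num)).trans
            (add_le_add_left (eLpNorm_add_le hm1 hm2 (by norm_num)) _)
      _ ≤ 2 ^ d * ENNReal.ofReal ε + c * (ENNReal.ofReal ε + eLpNorm f 2 volume) +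
          ENNReal.ofReal ε := by
          refine add_le_add (add_le_add ?_ ?_) ?_
          · exact (eLpNorm_comp_le_of_antilipschitzWith hφ hK (hf.sub hh).1).trans
              (mul_le_mul_right hfh _)
          · refine hgrad.trans ((mul_le_mul_right (mul_le_mul_right
              (eLpNorm_fderiv_le h hsupp) _) _).trans ?_)
            rw [← mul_assoc (d : ℝ≥0∞), ← mul_assoc (2 ^ d : ℝ≥0∞), ← mul_assoc (supNorm τ)]
            exact mul_le_mul_right hhf _
          · rw [eLpNorm_sub_comm]
            exact hfh
      _ = _ := by ring
  have hlim : Filter.Tendsto (fun ε : ℝ => ENNReal.ofReal ε * (2 ^ d + c + 1) +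
      c * eLpNorm f 2 volume) (nhdsWithin 0 (Set.Ioi 0))
      (nhds (0 * (2 ^ d + c + 1) + c * eLpNorm f 2 volume)) := by
    refine Filter.Tendsto.add_const _ (ENNReal.Tendsto.mul_const ?_ (Or.inr (by finiteness)))
    have := (ENNReal.continuous_ofReal.tendsto 0).mono_left
      (nhdsWithin_le_nhds (s := Set.Ioi (0 : ℝ)))
    rwa [ENNReal.ofReal_zero] at this
  have hle := ge_of_tendsto hlim (Filter.eventually_of_mem self_mem_nhdsWithin key)
  refine hle.trans (le_of_eq ?_)
  rw [zero_mul, zero_add, hc]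
  ring

/-! ### Modulation and the full deformation bound -/

theorem enorm_exp_sub_one_le (s : ℝ) :
    ‖Complex.exp (2 * Real.pi * Complex.I * s) - 1‖ₑ ≤ ENNReal.ofReal (2 * Real.pi) * ‖s‖ₑ := by
  have h1 : ‖Complex.exp (Complex.I * (2 * Real.pi * s : ℝ)) - 1‖ ≤ ‖2 * Real.pi * s‖ :=
    Real.norm_exp_I_mul_ofReal_sub_one_le
  rw [← ofReal_norm, ← ofReal_norm, ← ENNReal.ofReal_mul (by positivity)]
  refine ENNReal.ofReal_le_ofReal ?_
  rw [norm_mul (2 * Real.pi), Real.norm_of_nonneg (by positivity : 0 ≤ 2 * Real.pi)] at h1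
  convert! h1 using 4
  push_cast
  ring

theorem memLp_deform {d : ℕ} {f : Dom d → ℂ} (hf : MemLp f 2 volume) {τ : Dom d → Dom d}
    (hτ : LipschitzWith (1 / 2) τ) {ω : Dom d → ℝ} (hω : Continuous ω) :
    MemLp (deform τ ω f) 2 volume := by
  have hφ : Continuous fun x => x - τ x := continuous_id.sub hτ.continuous
  have hK : AntilipschitzWith 2 fun x => x - τ x := by
    simpa using antilipschitzWith_sub_smul hτ (t := 1) (by simp)
  have hcomp := memLp_comp_of_antilipschitzWith hφ hK hf
  refine hcomp.of_le (AEStronglyMeasurable.mul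
    (Continuous.aestronglyMeasurable (by fun_prop)) hcomp.1)
    (Filter.Eventually.of_forall fun x => ?_)
  have h1 : (2 * Real.pi * Complex.I * ω x : ℂ) = ((2 * Real.pi * ω x : ℝ) : ℂ) * Complex.I := by
    push_cast
    ring
  rw [deform, norm_mul, h1, Complex.norm_exp_ofReal_mul_I, one_mul]

theorem eLpNorm_deform_sub_comp_le {d : ℕ} {f : Dom d → ℂ} (hf : MemLp f 2 volume)
    {τ : Dom d → Dom d} (hτ : LipschitzWith (1 / 2) τ) (ω : Dom d → ℝ) (hW : supNorm ω ≠ ∞) :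
    eLpNorm (fun x => deform τ ω f x - f (x - τ x)) 2 volume ≤
      ENNReal.ofReal (2 * Real.pi) * supNorm ω * (2 ^ d * eLpNorm f 2 volume) := by
  have hφ : Continuous fun x => x - τ x := continuous_id.sub hτ.continuous
  have hK : AntilipschitzWith 2 fun x => x - τ x := by
    simpa using antilipschitzWith_sub_smul hτ (t := 1) (by simp)
  have hfin : ENNReal.ofReal (2 * Real.pi) * supNorm ω ≠ ∞ := by finiteness
  refine le_trans ?_ (mul_le_mul_right (eLpNorm_comp_le_of_antilipschitzWith hφ hK hf.1) _)
  lift ENNReal.ofReal (2 * Real.pi) * supNorm ω to ℝ≥0 using hfin with c hc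
  have := eLpNorm_le_nnreal_smul_eLpNorm_of_ae_le_mul (μ := (volume : Measure (Dom d)))
    (f := fun x => deform τ ω f x - f (x - τ x)) (g := fun x => f (x - τ x)) (c := c)
    (Filter.Eventually.of_forall fun x => ?_) 2
  · simpa [ENNReal.smul_def] using this
  · have h1 : ‖deform τ ω f x - f (x - τ x)‖ₑ ≤ c * ‖f (x - τ x)‖ₑ := by
      have h2 : deform τ ω f x - f (x - τ x) =
          (Complex.exp (2 * Real.pi * Complex.I * ω x) - 1) * f (x - τ x) := by
        rw [deform]
        ring
      rw [h2, enorm_mul, hc]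
      exact mul_le_mul_left ((enorm_exp_sub_one_le _).trans
        (mul_le_mul_right (enorm_le_supNorm ω x) _)) _
    rw [enorm_eq_nnnorm, enorm_eq_nnnorm] at h1
    exact_mod_cast h1

/-- The sensitivity of a band-limited function to deformations. -/
theorem eLpNorm_deform_sub_le {d : ℕ} (hd : 0 < d) {R : ℝ} (hR : 0 < R) {f : Dom d → ℂ}
    (hf : MemLp f 2 volume) (hb : BandLimited R (hf.toLp f)) {τ : Dom d → Dom d}
    (hτ : LipschitzWith (1 / 2) τ) {ω : Dom d → ℝ} (hω : Continuous ω) :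
    eLpNorm (deform τ ω f - f) 2 volume ≤
      ENNReal.ofReal (2 ^ d * (4 * Real.pi * d)) *
        (ENNReal.ofReal R * supNorm τ + supNorm ω) * eLpNorm f 2 volume := by
  have hφ : Continuous fun x => x - τ x := continuous_id.sub hτ.continuous
  have hK : AntilipschitzWith 2 fun x => x - τ x := by
    simpa using antilipschitzWith_sub_smul hτ (t := 1) (by simp)
  have hd' : (1 : ℝ) ≤ d := by exact_mod_cast hd
  have hC : (0 : ℝ) < 2 ^ d * (4 * Real.pi * d) := by positivity
  have hcomp := memLp_comp_of_antilipschitzWith hφ hK hf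
  have hdef := memLp_deform hf hτ hω
  -- Under `∞ · 0 = 0` the bound is `0` here even for unbounded `τ` or `ω`, so the left side must
  -- vanish. It does, because `id - τ` pulls null sets back to null sets.
  by_cases hf0 : eLpNorm f 2 volume = 0
  · have hfae : f =ᵐ[volume] 0 := (eLpNorm_eq_zero_iff hf.1 (by norm_num)).1 hf0
    have hdae : deform τ ω f - f =ᵐ[volume] 0 := by
      filter_upwards [hfae, (quasiMeasurePreserving_of_antilipschitzWith hφ hK).ae hfae]
        with x h1 h2
      rw [Pi.sub_apply, deform, h1, h2]
      simp
    rw [eLpNorm_congr_ae hdae, eLpNorm_zero]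
    exact zero_le
  by_cases htop : ENNReal.ofReal R * supNorm τ + supNorm ω = ∞
  · rw [htop, ENNReal.mul_top (by simpa using hC), ENNReal.top_mul hf0]
    exact le_top
  obtain ⟨hRT, hW⟩ := ENNReal.add_ne_top.1 htop
  have hT : supNorm τ ≠ ∞ := by
    intro h
    exact hRT (by rw [h, ENNReal.mul_top (by simpa using hR)])
  have hsplit : deform τ ω f - f =
      (fun x => deform τ ω f x - f (x - τ x)) + fun x => f (x - τ x) - f x := by
    funext x
    simp only [Pi.add_apply, Pi.sub_apply]
    ring
  have hCe : ENNReal.ofReal (2 ^ d * (4 * Real.pi * d)) =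
      2 ^ d * (ENNReal.ofReal (4 * Real.pi) * d) := by
    rw [ENNReal.ofReal_mul (by positivity), ENNReal.ofReal_mul (by positivity),
      ENNReal.ofReal_pow (by norm_num), ENNReal.ofReal_natCast]
    norm_num
  have hRe : ENNReal.ofReal (2 * Real.pi * (2 * R)) =
      ENNReal.ofReal (4 * Real.pi) * ENNReal.ofReal R := by
    rw [← ENNReal.ofReal_mul (by positivity)]
    congr 1
    ring
  -- The modulation constant `2π` is absorbed into the displacement constant; this uses `d ≥ 1`.
  have hpi : ENNReal.ofReal (2 * Real.pi) ≤ ENNReal.ofReal (4 * Real.pi) * d := by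
    rw [← ENNReal.ofReal_natCast, ← ENNReal.ofReal_mul (by positivity)]
    refine ENNReal.ofReal_le_ofReal ?_
    nlinarith [Real.pi_pos]
  rw [hsplit]
  calc _ ≤ eLpNorm (fun x => deform τ ω f x - f (x - τ x)) 2 volume +
        eLpNorm (fun x => f (x - τ x) - f x) 2 volume :=
        eLpNorm_add_le (hdef.sub hcomp).1 (hcomp.sub hf).1 (by norm_num)
    _ ≤ ENNReal.ofReal (4 * Real.pi) * d * supNorm ω * (2 ^ d * eLpNorm f 2 volume) +
        supNorm τ * (2 ^ d * (d * (ENNReal.ofReal (2 * Real.pi * (2 * R)) *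
          eLpNorm f 2 volume))) := by
        refine add_le_add ((eLpNorm_deform_sub_comp_le hf hτ ω hW).trans ?_)
          (eLpNorm_comp_sub_sub_le_of_bandLimited hR hf hb hτ hT)
        exact mul_le_mul_left (mul_le_mul_left hpi _) _
    _ = _ := by
        rw [hCe, hRe]
        ring

end DeepFeature

end

theorem theorem3 (d : ℕ) (hd : 0 < d) :
    ∃ C : ℝ, 0 < C ∧
      ∀ Ω : DeepFeature.ModuleSequence.{u} d, Ω.Admissible →
      ∀ R : ℝ, 0 < R →
      ∀ (f : DeepFeature.Dom d → ℂ) (hf : MemLp f 2 volume),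
        DeepFeature.BandLimited R (hf.toLp f) →
      ∀ (ω : DeepFeature.Dom d → ℝ) (τ : DeepFeature.Dom d → DeepFeature.Dom d),
        Continuous ω → ContDiff ℝ 1 τ →
        DeepFeature.jacobianSupNorm τ ≤ ENNReal.ofReal (1 / (2 * (d : ℝ))) →
        ∃ hF : MemLp (DeepFeature.deform τ ω f) 2 volume,
          DeepFeature.tripleNorm
              (Ω.feature (hF.toLp (DeepFeature.deform τ ω f)) - Ω.feature (hf.toLp f)) ≤
            ENNReal.ofReal C *
              (ENNReal.ofReal R * DeepFeature.supNorm τ + DeepFeature.supNorm ω) *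
              eLpNorm f 2 volume := by
  have hd' : (0 : ℝ) < d := by exact_mod_cast hd
  -- `2^d` comes from the change of variables, `d` from summing partial derivatives, and `4π = 2π ·
  -- 2` from Bernstein on the doubled band.
  refine ⟨2 ^ d * (4 * Real.pi * d), by positivity, ?_⟩
  intro Ω hΩ R hR f hf hb ω τ hω hτ hJ
  have hLip := DeepFeature.lipschitzWith_half hd hτ hJ
  have hF := DeepFeature.memLp_deform hf hLip hω
  refine ⟨hF, (Ω.tripleNorm_feature_sub_le hΩ _ _).trans ?_⟩
  rw [← MemLp.toLp_sub, Lp.enorm_toLp]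
  exact DeepFeature.eLpNorm_deform_sub_le hd hR hf hb hLip hω
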